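/- A lazy transposition $(a,b,p)$ of the $n$ positions $1,\dots,n$ (with $a\ne b$ and $p\in[0,1]$) exchanges the contents of positions $a$ and $b$ with probability $p$ and does nothing with probability $1-p$. For $0\le t\le n$, place $t$ distinguishable counters in positions $1,\dots,t$ and leave the other positions empty. A $(t,n)$-shuffle is a finite sequence of independent lazy transpositions of the $n$ positions which, performed in order, brings the $t$ counters to a placement that is uniformly distributed over all $t!\binom nt$ possible placements. Such sequences exist for all $0\le t\le n$; let $U_t(n)$ be the minimal length of a $(t,n)$-shuffle. There exists a constant $\varepsilon>0$ such that $$U_t(n)\le(1-\varepsilon)\left(tn-\binom{t+1}{2}\right)$$ for all integers $t,n$ with $3\le t\le n$ and $n\ge 6$. Moreover, for every integer $\ell\ge0$ there is a constant $C_\ell$, depending only on $\ell$, such that for all integers $r\ge0$ (in particular for $r\in\{0,1,2\}$) and all $n\ge t:=3\ell+r$ with $n\ge1$, $$U_t(n)\le(2\ell+r)\,n+C_\ell\log n.$$ -/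

import Mathlib

namespace LazyShuffle

/-- A lazy transposition `(a, b, p)` of the positions `Fin n`: with probability `p` it is the
transposition of the two distinct positions `a` and `b`, otherwise it is the identity. -/
structure LazyTransposition (n : ℕ) where
  a : Fin n
  b : Fin n
  a_ne_b : a ≠ b
  p : ℝ
  p_nonneg : 0 ≤ p
  p_le_one : p ≤ 1

/-- The probability that the random permutation `(a, b, p)` equals `σ`. -/
noncomputable def LazyTransposition.prob {n : ℕ} (T : LazyTransposition n)
    (σ : Equiv.Perm (Fin n)) : ℝ :=
  if σ = Equiv.swap T.a T.b then T.p else if σ = 1 then 1 - T.p else 0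

/-- The law of the composition of a sequence of independent lazy transpositions, performed in the
order of the list: `law L σ` is the probability that the resulting permutation of the positions is
`σ`, where `σ x` is the final position of whatever started in position `x`. If the first
permutation performed is `τ`, the remaining ones have to compose to `σ * τ⁻¹`. -/
noncomputable def law {n : ℕ} : List (LazyTransposition n) → Equiv.Perm (Fin n) → ℝ
  | [], σ => if σ = 1 then 1 else 0
  | T :: L, σ => ∑ τ : Equiv.Perm (Fin n), T.prob τ * law L (σ * τ⁻¹)

/-- Counters `0, …, t - 1` start in the first `t` of the `n` positions. This is the probability
that, after the sequence `L`, counter `i` is in position `f i` for every `i`. -/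
noncomputable def placementProb {t n : ℕ} (h : t ≤ n) (L : List (LazyTransposition n))
    (f : Fin t ↪ Fin n) : ℝ :=
  ∑ σ : Equiv.Perm (Fin n) with ∀ i : Fin t, σ (Fin.castLE h i) = f i, law L σ

/-- `L` is a `(t, n)`-shuffle: each of the `t! * (n choose t)` placements of the `t` distinguishable
counters in the `n` positions is equally likely. -/
def IsShuffle (t n : ℕ) (L : List (LazyTransposition n)) : Prop :=
  ∃ h : t ≤ n, ∀ f : Fin t ↪ Fin n,
    placementProb h L f = 1 / ((t.factorial : ℝ) * (n.choose t : ℝ))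

/-- The lengths of the `(t, n)`-shuffles. -/
def shuffleLengths (t n : ℕ) : Set ℕ :=
  {m | ∃ L : List (LazyTransposition n), IsShuffle t n L ∧ L.length = m}

/-- `U t n` is the minimal length of a `(t, n)`-shuffle. -/
noncomputable def U (t n : ℕ) : ℕ := sInf (shuffleLengths t n)

end LazyShuffle

namespace LazyShuffle

open Equiv

/-! The saving comes from three counters. Let T(n) be the least cost of shuffling three counters
over n positions. Spread one randomly chosen counter over a fresh copy of the n positions by a star
of n transpositions, keep it with suitable probability, and shuffle the original half by the given
sequence. This reaches exactly the placements with at most one counter in the new half, uniformly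
(`exists_expect_eq_leftSum`). Three counters always leave at most one in one of the two halves.
Hence fair transpositions between the n pairs of corresponding positions, whose effect is invariant
under exchanging the halves, symmetrize this law to the uniform one (`CanShuffle.double`). So T(2n)
≤ T(n) + 2n + 2, and with a single new position T(n+1) ≤ T(n) + 3 (`CanShuffle.succ`), which gives
T(n) ≤ 2n + O(log n) instead of about 3n.

More counters are handled in blocks: `CanShuffle.add` first shuffles some counters away from a
reserved set of positions, then shuffles the others over everything. Splitting into triples and
single counters gives both bounds.

Laws are handled dually, through expectations of observables on any set on which the permutations
act. The same sequence can then be followed on placements, on triples and on the group itself. -/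

/-- A lazy transposition of the positions in an arbitrary type. -/
structure LazySwap (α : Type*) where
  a : α
  b : α
  a_ne_b : a ≠ b
  p : ℝ
  p_nonneg : 0 ≤ p
  p_le_one : p ≤ 1

/-- Transport of a lazy transposition along an injection of the positions. -/
def LazySwap.map {α β : Type*} (e : α ↪ β) (T : LazySwap α) : LazySwap β :=
  ⟨e T.a, e T.b, e.injective.ne T.a_ne_b, T.p, T.p_nonneg, T.p_le_one⟩

/-- The expected value of the observable `G` after the lazy transpositions in `L`, started in the
state `x`. -/
def expect {α X : Type*} [DecidableEq α] [MulAction (Perm α) X] :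
    List (LazySwap α) → (X → ℝ) → X → ℝ
  | [], G, x => G x
  | T :: L, G, x => T.p * expect L G (swap T.a T.b • x) + (1 - T.p) * expect L G x

/-! ### Expectations of observables -/

section Expect

variable {α β X Y : Type*} [DecidableEq α] [DecidableEq β] [MulAction (Perm α) X]
  [MulAction (Perm β) Y]

@[simp] lemma expect_nil (G : X → ℝ) (x : X) :
    expect ([] : List (LazySwap α)) G x = G x := rfl

lemma expect_cons (T : LazySwap α) (L : List (LazySwap α)) (G : X → ℝ) (x : X) :
    expect (T :: L) G x = T.p * expect L G (swap T.a T.b • x) + (1 - T.p) * expect L G x := rfl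

lemma expect_append (L M : List (LazySwap α)) (G : X → ℝ) (x : X) :
    expect (L ++ M) G x = expect L (expect M G) x := by
  induction L generalizing x with
  | nil => rfl
  | cons T L ih => simp only [List.cons_append, expect_cons, ih]

lemma expect_map (e : α ↪ β) (φ : X → Y)
    (hφ : ∀ a b x, φ (swap a b • x) = swap (e a) (e b) • φ x)
    (L : List (LazySwap α)) (G : Y → ℝ) (x : X) :
    expect (L.map (LazySwap.map e)) G (φ x) = expect L (fun x => G (φ x)) x := by
  induction L generalizing x with
  | nil => rfl
  | cons T L ih =>
    simp only [List.map_cons, expect_cons, LazySwap.map, ← hφ, ih]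

lemma expect_comp {Z : Type*} [MulAction (Perm α) Z] (φ : X → Z)
    (hφ : ∀ (σ : Perm α) x, φ (σ • x) = σ • φ x) (L : List (LazySwap α)) (G : Z → ℝ) (x : X) :
    expect L G (φ x) = expect L (fun x => G (φ x)) x := by
  induction L generalizing x with
  | nil => rfl
  | cons T L ih => simp only [expect_cons, ← hφ, ih]

lemma expect_sum {ι : Type*} (s : Finset ι) (L : List (LazySwap α)) (G : ι → X → ℝ) (x : X) :
    expect L (fun x => ∑ i ∈ s, G i x) x = ∑ i ∈ s, expect L (G i) x := by
  induction L generalizing x with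
  | nil => rfl
  | cons T L ih =>
    simp only [expect_cons, ih, Finset.mul_sum, Finset.sum_add_distrib]

lemma expect_one (L : List (LazySwap α)) (x : X) : expect L (fun _ => 1) x = 1 := by
  induction L generalizing x with
  | nil => rfl
  | cons T L ih => simp [expect_cons, ih]

/-- The expectation along a star: if the transpositions of `s` with the leaves move the state `x`
to pairwise unrelated states `y b`, then all of these can be made equally likely. -/
lemma exists_star (s : α) (bs : List α) (hs : s ∉ bs) (hbs : bs.Nodup) (w : ℝ) (hw : 0 ≤ w)
    (hw1 : w * bs.length ≤ 1) :
    ∃ L : List (LazySwap α), L.length = bs.length ∧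
      ∀ (X : Type) [MulAction (Perm α) X] (G : X → ℝ) (x : X),
        ((∀ b ∈ bs, swap s b • x = x) → expect L G x = G x) ∧
        ∀ y : α → X, (∀ b ∈ bs, swap s b • x = y b) →
          (∀ b ∈ bs, ∀ b' ∈ bs, b ≠ b' → swap s b' • y b = y b) →
          expect L G x = w * (bs.map fun b => G (y b)).sum + (1 - w * bs.length) * G x := by
  induction bs generalizing w with
  | nil => exact ⟨[], rfl, fun X _ G x => ⟨fun _ => rfl, fun y _ _ => by simp⟩⟩
  | cons b bs ih =>
    simp only [List.mem_cons, not_or, List.nodup_cons, List.length_cons, Nat.cast_add,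
      Nat.cast_one] at *
    have hl : (0 : ℝ) ≤ bs.length := Nat.cast_nonneg _
    have hw1' : w ≤ 1 := by nlinarith
    -- After the first leaf is missed, the remaining leaves need conditional weight `w / (1 - w)`.
    -- If `w = 1` there are no further leaves, so the default value of the division is harmless.
    have key : (1 - w) * (w / (1 - w)) * bs.length = w * bs.length := by
      rcases eq_or_ne w 1 with rfl | h
      · have : (bs.length : ℝ) = 0 := by linarith
        simp [this]
      · have : 1 - w ≠ 0 := sub_ne_zero.2 h.symm
        field_simp
    have hsub : 0 ≤ 1 - w := by linarith
    have hle : w / (1 - w) * bs.length ≤ 1 := by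
      rw [div_mul_eq_mul_div]
      exact div_le_one_of_le₀ (by linarith) hsub
    obtain ⟨L, hL, h⟩ := ih hs.2 hbs.2 (w / (1 - w)) (by positivity) hle
    refine ⟨⟨s, b, hs.1, w, hw, hw1'⟩ :: L, by simp [hL], fun X _ G x => ⟨fun hx => ?_, ?_⟩⟩
    · rw [expect_cons, hx b (Or.inl rfl), (h X G x).1 fun c hc => hx c (Or.inr hc)]
      ring
    · intro y hx hy
      -- Once the counter has moved to `b`, the rest of the star no longer affects the state.
      rw [expect_cons, hx b (Or.inl rfl), (h X G (y b)).1 fun c hc =>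
          hy b (Or.inl rfl) c (Or.inr hc) (by rintro rfl; exact hbs.1 hc),
        (h X G x).2 y (fun c hc => hx c (Or.inr hc))
          fun c hc c' hc' => hy c (Or.inr hc) c' (Or.inr hc')]
      have key' : (1 - w) * (w / (1 - w)) * (bs.map fun b => G (y b)).sum
          = w * (bs.map fun b => G (y b)).sum := by
        rcases eq_or_ne w 1 with rfl | h
        · have : bs.length = 0 := by
            have : (bs.length : ℝ) = 0 := by linarith
            exact_mod_cast this
          rw [List.length_eq_zero_iff] at this
          simp [this]
        · have : 1 - w ≠ 0 := sub_ne_zero.2 h.symm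
          field_simp
      simp only [List.map_cons, List.sum_cons]
      linear_combination key' - G x * key

end Expect

/-! ### Uniform shuffling and composition of shuffles -/

/-- Started from the placement `x` of the counters, `L` makes all placements equally likely. -/
def Shuffles {κ α : Type*} [Fintype κ] [Fintype α] [DecidableEq κ] [DecidableEq α]
    (L : List (LazySwap α)) (x : κ → α) : Prop :=
  ∃ c : ℝ, ∀ G : (κ → α) → ℝ, expect L G x = c * ∑ f : κ ↪ α, G f

/-- Counters indexed by `κ` can be shuffled over the positions `α` by `k` lazy transpositions. -/
def CanShuffle (κ α : Type*) [Fintype κ] [Fintype α] [DecidableEq κ] [DecidableEq α]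
    (k : ℕ) : Prop :=
  ∃ (f : κ ↪ α) (L : List (LazySwap α)), L.length = k ∧ Shuffles L f

/-- A bijection between the two images extends to the complements by finiteness. Thus relabelling
positions makes the starting placement of a shuffle irrelevant. -/
lemma exists_equiv_comp_eq {κ α α' : Type*} [Fintype κ] [Fintype α'] [DecidableEq α']
    (f : κ ↪ α) (f' : κ ↪ α') (e : α ≃ α') :
    ∃ e' : α ≃ α', ∀ i, e' (f i) = f' i := by
  let g : Set.range f ≃ Set.range f' :=
    (Equiv.ofInjective f f.injective).symm.trans (Equiv.ofInjective f' f'.injective)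
  let g' : {x // x ∈ Set.range (f.trans e.toEmbedding)} ≃ {x // x ∈ Set.range f'} :=
    (Equiv.ofInjective _ (f.trans e.toEmbedding).injective).symm.trans
      (Equiv.ofInjective f' f'.injective)
  refine ⟨e.trans g'.extendSubtype, fun i => ?_⟩
  have hmem : e (f i) ∈ Set.range (f.trans e.toEmbedding) := ⟨i, rfl⟩
  rw [Equiv.trans_apply, Equiv.extendSubtype_apply_of_mem _ _ hmem]
  have : (Equiv.ofInjective _ (f.trans e.toEmbedding).injective).symm ⟨e (f i), hmem⟩ = i := by
    rw [Equiv.symm_apply_eq]; rfl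
  simp only [g', Equiv.trans_apply, this]
  rfl

section Shuffles

variable {κ κ' α α' : Type*} [Fintype κ] [Fintype α] [DecidableEq κ] [DecidableEq α]
  [Fintype κ'] [Fintype α'] [DecidableEq κ'] [DecidableEq α']

lemma Shuffles.congr {L : List (LazySwap α)} {f : κ → α} (h : Shuffles L f)
    (e : κ ≃ κ') (e' : α ≃ α') :
    Shuffles (L.map (LazySwap.map e'.toEmbedding)) (e' ∘ f ∘ e.symm) := by
  obtain ⟨c, hc⟩ := h
  refine ⟨c, fun G => ?_⟩
  rw [expect_map e'.toEmbedding (fun g : κ → α => e' ∘ g ∘ e.symm), hc]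
  · congr 1
    refine Fintype.sum_equiv (Equiv.embeddingCongr e e') _ _ fun g => ?_
    congr 1
  · intro a b g
    funext i
    simp only [Function.comp_apply, Pi.smul_apply, Perm.smul_def, Equiv.coe_toEmbedding]
    rw [Equiv.swap_apply_def, Equiv.swap_apply_def]
    simp only [EmbeddingLike.apply_eq_iff_eq]
    split_ifs <;> rfl

lemma CanShuffle.exists_shuffles {k : ℕ} (h : CanShuffle κ α k) (e : κ ≃ κ') (e' : α ≃ α')
    (f' : κ' ↪ α') : ∃ L : List (LazySwap α'), L.length = k ∧ Shuffles L f' := by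
  obtain ⟨f, L, hL, hs⟩ := h
  obtain ⟨e₁, he₁⟩ := exists_equiv_comp_eq f (e.toEmbedding.trans f') e'
  have h2 : e₁ ∘ f ∘ e.symm = f' := by
    funext i
    simp [he₁]
  exact ⟨_, by simpa using hL, h2 ▸ hs.congr e e₁⟩

lemma CanShuffle.congr {k : ℕ} (h : CanShuffle κ α k) (e : κ ≃ κ') (e' : α ≃ α') :
    CanShuffle κ' α' k := by
  obtain ⟨f, -⟩ := id h
  let f' : κ' ↪ α' := (e.symm.toEmbedding.trans f).trans e'.toEmbedding
  obtain ⟨L, hL, hs⟩ := h.exists_shuffles e e' f'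
  exact ⟨f', L, hL, hs⟩

lemma canShuffle_of_isEmpty [IsEmpty κ] : CanShuffle κ α 0 := by
  refine ⟨⟨isEmptyElim, fun i => isEmptyElim i⟩, [], rfl, 1, fun G => ?_⟩
  rw [expect_nil, one_mul, Fintype.sum_unique]
  congr 1

-- Once the counters in `κ` sit at `σ ∘ inl`, the free positions are exactly `σ ∘ inr`. A uniform
-- placement in `β` is therefore carried to a uniform extension, whatever `σ` does there.
omit [DecidableEq κ'] in
lemma sum_embedding_sum_extending {β : Type*} [Fintype β] [DecidableEq β]
    (G : (κ ⊕ κ' → κ ⊕ β) → ℝ) (σ : Perm (κ ⊕ β)) :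
    ∑ g : κ' ↪ β, G (σ • Sum.elim Sum.inl (Sum.inr ∘ g)) =
      ∑ f : κ ⊕ κ' ↪ κ ⊕ β, if (fun i => f (Sum.inl i)) = σ • Sum.inl then G f else 0 := by
  rw [← Finset.sum_filter]
  refine Finset.sum_bij
    (fun g _ => ⟨σ • Sum.elim Sum.inl (Sum.inr ∘ g), σ.injective.comp
      (Sum.inl_injective.sumElim (Sum.inr_injective.comp g.injective) (by simp))⟩) ?_ ?_ ?_ ?_
  · intro g _
    simp only [Finset.mem_filter, Finset.mem_univ, true_and]
    rfl
  · intro g _ g' _ h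
    ext i
    have := DFunLike.congr_fun h (Sum.inr i)
    simpa using this
  · intro f hf
    simp only [Finset.mem_filter, Finset.mem_univ, true_and] at hf
    have hinr : ∀ j : κ', ∃ b : β, σ.symm (f (Sum.inr j)) = Sum.inr b := by
      intro j
      rcases h : σ.symm (f (Sum.inr j)) with i | b
      · exfalso
        rw [Equiv.symm_apply_eq] at h
        have h2 : f (Sum.inl i) = σ (Sum.inl i) := congrFun hf i
        exact Sum.inr_ne_inl (f.injective (h.trans h2.symm))
      · exact ⟨b, rfl⟩
    choose g hg using hinr
    have hg' : ∀ j, σ (Sum.inr (g j)) = f (Sum.inr j) := fun j => by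
      rw [← hg j, Equiv.apply_symm_apply]
    refine ⟨⟨g, fun j j' h => ?_⟩, Finset.mem_univ _, ?_⟩
    · have := hg' j
      rw [h, hg' j'] at this
      exact (Sum.inr_injective (f.injective this)).symm
    · ext i
      rcases i with i | j
      · exact (congrFun hf i).symm
      · exact hg' j
  · intro g _
    rfl

/-- First shuffle the counters in `κ'` over `β`, then shuffle those in `κ` over `κ ⊕ β`. -/
lemma CanShuffle.add {β : Type*} [Fintype β] [DecidableEq β] {k k' : ℕ}
    (h : CanShuffle κ (κ ⊕ β) k) (h' : CanShuffle κ' β k') :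
    CanShuffle (κ ⊕ κ') (κ ⊕ β) (k + k') := by
  obtain ⟨L, hL, c, hc⟩ := h.exists_shuffles (Equiv.refl _) (Equiv.refl _) ⟨_, Sum.inl_injective⟩
  obtain ⟨f', L', hL', c', hc'⟩ := h'
  refine ⟨⟨Sum.elim Sum.inl (Sum.inr ∘ f'), Sum.inl_injective.sumElim
    (Sum.inr_injective.comp f'.injective) (by simp)⟩,
    L'.map (LazySwap.map ⟨_, Sum.inr_injective⟩) ++ L, by simp [hL, hL', add_comm],
    c' * c, fun G => ?_⟩
  rw [expect_append]
  refine (expect_map _ (fun g : κ' → β => (Sum.elim Sum.inl (Sum.inr ∘ g) : κ ⊕ κ' → κ ⊕ β))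
    ?_ L' (expect L G) f').trans ?_
  · intro a b g
    funext i
    rcases i with i | i
    · simp [Equiv.swap_apply_of_ne_of_ne]
    · simp only [Sum.elim_inr, Function.comp_apply, Pi.smul_apply, Perm.smul_def,
        Function.Embedding.coeFn_mk, Equiv.swap_apply_def, Sum.inr.injEq]
      split_ifs <;> rfl
  rw [hc', mul_assoc]
  congr 1
  -- Pulling back to the group makes the random `σ` common to all `g`, so the sum over `g` can be
  -- taken inside the expectation.
  have h1 : ∀ g : κ' → β, expect L G (Sum.elim Sum.inl (Sum.inr ∘ g)) =
      expect L (fun σ : Perm (κ ⊕ β) => G (σ • Sum.elim Sum.inl (Sum.inr ∘ g))) 1 := by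
    intro g
    rw [← expect_comp (fun σ : Perm (κ ⊕ β) => σ • (Sum.elim Sum.inl (Sum.inr ∘ g)))
      (fun σ τ => by simp [mul_smul]), one_smul]
  simp only [h1]
  rw [← expect_sum]
  simp only [sum_embedding_sum_extending]
  have h2 := expect_comp (fun σ : Perm (κ ⊕ β) => σ • (Sum.inl : κ → κ ⊕ β))
    (fun σ τ => by simp [mul_smul]) L
    (fun x => ∑ f : κ ⊕ κ' ↪ κ ⊕ β, if (fun i => f (Sum.inl i)) = x then G f else 0) 1
  rw [← h2, one_smul]
  refine (hc _).trans ?_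
  congr 1
  rw [Finset.sum_comm]
  refine Finset.sum_congr rfl fun f _ => ?_
  rw [Finset.sum_eq_single ⟨fun i => f (Sum.inl i), f.injective.comp Sum.inl_injective⟩]
  · simp
  · intro g _ hg
    rw [if_neg]
    intro h
    exact hg (by ext i; exact (congrFun h i).symm)
  · simp

end Shuffles

end LazyShuffle

namespace LazyShuffle

open Equiv

/-! ### Sums over distinct triples -/

/-- The sum of `F` over all triples of distinct elements. -/
def distinctSum {α : Type*} [Fintype α] [DecidableEq α] (F : α × α × α → ℝ) : ℝ :=
  ∑ x, ∑ y, ∑ z, if x ≠ y ∧ x ≠ z ∧ y ≠ z then F (x, y, z) else 0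

/-- The sum of `F` over all pairs of distinct elements. -/
def distinctSumPair {α : Type*} [Fintype α] [DecidableEq α] (F : α → α → ℝ) : ℝ :=
  ∑ x, ∑ y, if x ≠ y then F x y else 0

section DistinctSum

variable {α β : Type*} [Fintype α] [DecidableEq α] [Fintype β] [DecidableEq β]

/-- Triples as functions on `Fin 3`. -/
def tripleEquiv (α : Type*) : α × α × α ≃ (Fin 3 → α) where
  toFun p := ![p.1, p.2.1, p.2.2]
  invFun f := (f 0, f 1, f 2)
  left_inv _ := rfl
  right_inv f := by
    funext i
    fin_cases i <;> rfl

lemma injective_vec_three {α : Type*} {x y z : α} :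
    Function.Injective ![x, y, z] ↔ x ≠ y ∧ x ≠ z ∧ y ≠ z := by
  constructor
  · intro h
    exact ⟨h.ne (a₁ := 0) (a₂ := 1) (by decide), h.ne (a₁ := 0) (a₂ := 2) (by decide),
      h.ne (a₁ := 1) (a₂ := 2) (by decide)⟩
  · rintro ⟨h1, h2, h3⟩ i j hij
    fin_cases i <;> fin_cases j <;> simp_all

lemma sum_embedding_fin_three (G : (Fin 3 → α) → ℝ) :
    ∑ f : Fin 3 ↪ α, G f = distinctSum fun p => G (tripleEquiv α p) := by
  classical
  have h : ∑ f : Fin 3 ↪ α, G f = ∑ f : Fin 3 → α, if Function.Injective f then G f else 0 := by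
    rw [← Finset.sum_filter]
    refine Finset.sum_bij (fun f _ => f) ?_ ?_ ?_ ?_
    · intro f _
      simp [f.injective]
    · intro f _ g _ h
      exact DFunLike.coe_injective h
    · intro f hf
      exact ⟨⟨f, by simpa using hf⟩, Finset.mem_univ _, rfl⟩
    · intro f _
      rfl
  rw [h, ← (tripleEquiv α).sum_comp, Fintype.sum_prod_type]
  simp only [Fintype.sum_prod_type, distinctSum]
  exact Finset.sum_congr rfl fun x _ => Finset.sum_congr rfl fun y _ =>
    Finset.sum_congr rfl fun z _ => if_congr injective_vec_three rfl rfl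

lemma distinctSum_swap₁₂ (F : α × α × α → ℝ) :
    (distinctSum fun p => F (p.2.1, p.1, p.2.2)) = distinctSum F := by
  unfold distinctSum
  rw [Finset.sum_comm]
  refine Finset.sum_congr rfl fun x _ => Finset.sum_congr rfl fun y _ =>
    Finset.sum_congr rfl fun z _ => if_congr ?_ rfl rfl
  simp only [ne_comm (a := x) (b := y)]
  tauto

lemma distinctSum_swap₂₃ (F : α × α × α → ℝ) :
    (distinctSum fun p => F (p.1, p.2.2, p.2.1)) = distinctSum F := by
  unfold distinctSum
  refine Finset.sum_congr rfl fun x _ => ?_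
  rw [Finset.sum_comm]
  refine Finset.sum_congr rfl fun y _ => Finset.sum_congr rfl fun z _ => if_congr ?_ rfl rfl
  simp only [ne_comm (a := z) (b := y)]
  tauto

/-- Each pair of distinct elements has `card α - 2` choices for the third entry. This is the
two-counter marginal of the uniform law. -/
lemma distinctSum_eq_pair (F : α → α → ℝ) :
    (distinctSum fun p => F p.1 p.2.1) = ((Fintype.card α : ℝ) - 2) * distinctSumPair F := by
  simp only [distinctSum, distinctSumPair, Finset.mul_sum]
  refine Finset.sum_congr rfl fun x _ => Finset.sum_congr rfl fun y _ => ?_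
  rcases eq_or_ne x y with rfl | h
  · simp
  · have h1 : ∀ z, (if x ≠ y ∧ x ≠ z ∧ y ≠ z then F x y else 0) =
        F x y - (if z = x then F x y else 0) - (if z = y then F x y else 0) := by
      intro z
      rcases eq_or_ne z x with rfl | hx
      · simp [h]
      · rcases eq_or_ne z y with rfl | hy
        · simp [h, h.symm]
        · simp [h, hx, hy, hx.symm, hy.symm]
    rw [Finset.sum_congr rfl fun z _ => h1 z]
    simp only [Finset.sum_sub_distrib, Finset.sum_ite_eq', Finset.mem_univ, if_true,
      Finset.sum_const, Finset.card_univ, nsmul_eq_mul, if_pos h]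
    ring

lemma distinctSum_smul (σ : Perm α) (F : α × α × α → ℝ) :
    (distinctSum fun p => F (σ • p)) = distinctSum F := by
  symm
  unfold distinctSum
  rw [← Equiv.sum_comp σ]
  refine Finset.sum_congr rfl fun x _ => ?_
  rw [← Equiv.sum_comp σ]
  refine Finset.sum_congr rfl fun y _ => ?_
  rw [← Equiv.sum_comp σ]
  refine Finset.sum_congr rfl fun z _ => ?_
  simp only [ne_eq, EmbeddingLike.apply_eq_iff_eq]
  rfl

lemma distinctSum_add (F G : α × α × α → ℝ) :
    (distinctSum fun p => F p + G p) = distinctSum F + distinctSum G := by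
  simp only [distinctSum, ← Finset.sum_add_distrib]
  refine Finset.sum_congr rfl fun x _ => Finset.sum_congr rfl fun y _ =>
    Finset.sum_congr rfl fun z _ => ?_
  split_ifs <;> simp

lemma distinctSum_mul (c : ℝ) (F : α × α × α → ℝ) :
    (distinctSum fun p => c * F p) = c * distinctSum F := by
  simp only [distinctSum, Finset.mul_sum, mul_ite, mul_zero]

/-- Every permutation preserves the set of distinct triples, so the uniform law is stationary. -/
lemma distinctSum_expect (L : List (LazySwap α)) (F : α × α × α → ℝ) :
    distinctSum (expect L F) = distinctSum F := by
  induction L with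
  | nil => rfl
  | cons T L ih =>
    have : expect (T :: L) F = fun p => T.p * expect L F (swap T.a T.b • p) +
      (1 - T.p) * expect L F p := rfl
    rw [this, distinctSum_add, distinctSum_mul, distinctSum_mul,
      distinctSum_smul (swap T.a T.b) (expect L F), ih]
    ring

/-- The part of the sum over distinct triples in `α ⊕ β` that has at most one entry in `β`. -/
def leftSum (G : (α ⊕ β) × (α ⊕ β) × (α ⊕ β) → ℝ) : ℝ :=
  (distinctSum fun p : α × α × α => G (Sum.inl p.1, Sum.inl p.2.1, Sum.inl p.2.2)) +
  (∑ b : β, distinctSumPair fun x y : α => G (Sum.inr b, Sum.inl x, Sum.inl y)) +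
  (∑ b : β, distinctSumPair fun x y : α => G (Sum.inl x, Sum.inr b, Sum.inl y)) +
  ∑ b : β, distinctSumPair fun x y : α => G (Sum.inl x, Sum.inl y, Sum.inr b)

/-- Of three entries, either at most one lies in `β` or at most one lies in `α`, and never both. -/
lemma distinctSum_sum (G : (α ⊕ β) × (α ⊕ β) × (α ⊕ β) → ℝ) :
    distinctSum G = leftSum G +
      leftSum fun p : (β ⊕ α) × (β ⊕ α) × (β ⊕ α) => G (p.1.swap, p.2.1.swap, p.2.2.swap) := by
  simp only [leftSum, distinctSum, distinctSumPair, Fintype.sum_sum_type, Sum.swap_inl,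
    Sum.swap_inr, Finset.sum_add_distrib, ne_eq, Sum.inl.injEq, Sum.inr.injEq, reduceCtorEq,
    not_false_eq_true, and_true, true_and]
  have e1 : ∀ F : α → α → β → ℝ,
      ∑ x : α, ∑ y : α, ∑ b : β, (if ¬ x = y then F x y b else 0) =
      ∑ b : β, ∑ x : α, ∑ y : α, (if ¬ x = y then F x y b else 0) := by
    intro F
    rw [Finset.sum_comm (s := (Finset.univ : Finset β))]
    exact Finset.sum_congr rfl fun x _ => Finset.sum_comm
  have e2 : ∀ F : β → β → α → ℝ,
      ∑ x : β, ∑ y : β, ∑ b : α, (if ¬ x = y then F x y b else 0) =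
      ∑ b : α, ∑ x : β, ∑ y : β, (if ¬ x = y then F x y b else 0) := by
    intro F
    rw [Finset.sum_comm (s := (Finset.univ : Finset α))]
    exact Finset.sum_congr rfl fun x _ => Finset.sum_comm
  have e3 : ∀ F : α → β → α → ℝ,
      ∑ x : α, ∑ b : β, ∑ y : α, (if ¬ x = y then F x b y else 0) =
      ∑ b : β, ∑ x : α, ∑ y : α, (if ¬ x = y then F x b y else 0) :=
    fun F => Finset.sum_comm
  have e4 : ∀ F : β → α → β → ℝ,
      ∑ x : β, ∑ b : α, ∑ y : β, (if ¬ x = y then F x b y else 0) =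
      ∑ b : α, ∑ x : β, ∑ y : β, (if ¬ x = y then F x b y else 0) :=
    fun F => Finset.sum_comm
  rw [e1 fun x y b => G (Sum.inl x, Sum.inl y, Sum.inr b),
    e2 fun x y b => G (Sum.inr x, Sum.inr y, Sum.inl b),
    e3 fun x b y => G (Sum.inl x, Sum.inr b, Sum.inl y),
    e4 fun x b y => G (Sum.inr x, Sum.inl b, Sum.inr y)]
  ring

end DistinctSum

/-! ### Moving at most one of three counters to new positions -/

section Triples

variable {α β : Type} [Fintype α] [DecidableEq α] [Fintype β] [DecidableEq β]

lemma shuffles_fin_three_iff (L : List (LazySwap α)) (p : α × α × α) :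
    Shuffles L (tripleEquiv α p) ↔
      ∃ c : ℝ, ∀ G : α × α × α → ℝ, expect L G p = c * distinctSum G := by
  have hφ : ∀ (σ : Perm α) (p : α × α × α), tripleEquiv α (σ • p) = σ • tripleEquiv α p := by
    intro σ p
    funext i
    fin_cases i <;> rfl
  constructor
  · rintro ⟨c, hc⟩
    refine ⟨c, fun G => ?_⟩
    have := hc fun f => G ((tripleEquiv α).symm f)
    rw [expect_comp _ hφ, sum_embedding_fin_three fun f => G ((tripleEquiv α).symm f)] at this
    simpa using this
  · rintro ⟨c, hc⟩
    refine ⟨c, fun G => ?_⟩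
    rw [expect_comp _ hφ, sum_embedding_fin_three]
    exact hc _

/-- Counters that are shuffled over `α` after one of them has possibly been moved to `β`. -/
lemma exists_expect_eq_leftSum {k : ℕ} (h : CanShuffle (Fin 3) α k) (hβ : 0 < Fintype.card β) :
    ∃ (p : α × α × α) (L : List (LazySwap (α ⊕ β))), p.1 ≠ p.2.1 ∧ p.1 ≠ p.2.2 ∧ p.2.1 ≠ p.2.2 ∧
      L.length = 2 + Fintype.card β + k ∧ ∃ c : ℝ, ∀ G : (α ⊕ β) × (α ⊕ β) × (α ⊕ β) → ℝ,
        expect L G (Sum.inl p.1, Sum.inl p.2.1, Sum.inl p.2.2) = c * leftSum G := by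
  obtain ⟨f, L, hL, hs⟩ := h
  obtain ⟨⟨a₀, a₁, a₂⟩, hp⟩ : ∃ p, tripleEquiv α p = f := (tripleEquiv α).surjective f
  obtain ⟨h01, h02, h12⟩ : a₀ ≠ a₁ ∧ a₀ ≠ a₂ ∧ a₁ ≠ a₂ :=
    injective_vec_three.1 (show Function.Injective (tripleEquiv α (a₀, a₁, a₂)) from
      hp ▸ f.injective)
  rw [← hp, shuffles_fin_three_iff] at hs
  obtain ⟨c, hc⟩ := hs
  have hcard : (3 : ℝ) ≤ Fintype.card α := by
    have := Fintype.card_le_of_embedding f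
    rw [Fintype.card_fin] at this
    exact_mod_cast this
  have hβ' : (0 : ℝ) < Fintype.card β := by exact_mod_cast hβ
  set m : ℝ := (Fintype.card α : ℝ) with hm
  set M : ℝ := (Fintype.card β : ℝ) with hM
  have hden : 0 < 3 * M + m - 2 := by linarith
  -- There are m(m-1)(m-2) target placements inside `α` and 3Mm(m-1) with one counter in `β`. The
  -- latter must have total probability 3M/(3M+m-2), shared equally by the M leaves.
  obtain ⟨S, hS, hstar⟩ := exists_star (Sum.inl a₀ : α ⊕ β)
    ((Finset.univ : Finset β).toList.map Sum.inr) (by simp)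
    ((Finset.nodup_toList _).map Sum.inr_injective) (3 / (3 * M + m - 2))
    (by positivity) (by
      rw [List.length_map, Finset.length_toList, Finset.card_univ, div_mul_eq_mul_div,
        div_le_one hden]
      linarith)
  rw [List.length_map, Finset.length_toList, Finset.card_univ] at hS
  have hSG : ∀ (X : Type) [MulAction (Perm (α ⊕ β)) X] (G : X → ℝ) (x : X) (y : β → X),
      (∀ b, swap (Sum.inl a₀) (Sum.inr b) • x = y b) →
      (∀ b b', b ≠ b' → swap (Sum.inl a₀) (Sum.inr b') • y b = y b) →
      expect S G x = 3 / (3 * M + m - 2) * ∑ b, G (y b) +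
        (1 - 3 / (3 * M + m - 2) * M) * G x := by
    intro X _ G x y hx hy
    have := (hstar X G x).2 (fun b => Sum.elim (fun _ => x) y b)
      (by simpa using hx) (by simpa using hy)
    rw [this, List.length_map, Finset.length_toList, Finset.card_univ, List.map_map,
      ← Finset.sum_map_toList]
    rfl
  have hL' : ∀ (G : (α ⊕ β) × (α ⊕ β) × (α ⊕ β) → ℝ)
      (φ : α × α × α → (α ⊕ β) × (α ⊕ β) × (α ⊕ β)),
      (∀ (a b : α) x, φ (swap a b • x) =
        swap (Sum.inl a : α ⊕ β) (Sum.inl b) • φ x) →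
      expect (L.map (LazySwap.map (β := α ⊕ β) ⟨_, Sum.inl_injective⟩)) G (φ (a₀, a₁, a₂)) =
        c * distinctSum fun p => G (φ p) := by
    intro G φ hφ
    rw [expect_map _ φ hφ, hc]
  have hswap : ∀ a b x : α, (Sum.inl (swap a b x) : α ⊕ β) = swap (Sum.inl a) (Sum.inl b)
      (Sum.inl x) := by
    intro a b x
    simp only [Equiv.swap_apply_def, Sum.inl.injEq]
    split_ifs <;> rfl
  -- Probabilities 1/2 and then 1/3 put each of the three counters at `a₀`, the centre of the star,
  -- with probability 1/3.
  refine ⟨(a₀, a₁, a₂), ⟨Sum.inl a₀, Sum.inl a₁, by simpa using h01, 1 / 2, by norm_num,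
    by norm_num⟩ :: ⟨Sum.inl a₀, Sum.inl a₂, by simpa using h02, 1 / 3, by norm_num,
    by norm_num⟩ :: (S ++ L.map (LazySwap.map (β := α ⊕ β) ⟨_, Sum.inl_injective⟩)), h01, h02, h12, ?_,
    c * ((m - 2) / (3 * M + m - 2)), fun G => ?_⟩
  · simp [hS, hL]
    ring
  set H := expect (L.map (LazySwap.map (β := α ⊕ β) ⟨_, Sum.inl_injective⟩)) G with hH
  -- If all counters stay in `α`, permuting their labels by `φ` does not disturb uniformity.
  have A : ∀ φ : α × α × α → α × α × α, (∀ (σ : Perm α) p, φ (σ • p) = σ • φ p) →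
      (∀ F : α × α × α → ℝ, (distinctSum fun p => F (φ p)) = distinctSum F) →
      H (Sum.inl (φ (a₀, a₁, a₂)).1, Sum.inl (φ (a₀, a₁, a₂)).2.1,
        Sum.inl (φ (a₀, a₁, a₂)).2.2) =
      c * distinctSum fun p : α × α × α => G (Sum.inl p.1, Sum.inl p.2.1, Sum.inl p.2.2) := by
    intro φ hφ hD
    rw [hH, hL' G fun p => (Sum.inl (φ p).1, Sum.inl (φ p).2.1, Sum.inl (φ p).2.2)]
    · rw [hD fun p => G (Sum.inl p.1, Sum.inl p.2.1, Sum.inl p.2.2)]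
    · intro a b x
      simp only [hφ, Prod.smul_fst, Prod.smul_snd, Perm.smul_def, Prod.smul_mk, hswap]
  -- If one counter has left for `b`, the other two follow the two-counter marginal of the shuffle,
  -- and `L` never touches `b`.
  have B : ∀ (b : β) (φ : α × α × α → α × α × α), (∀ (σ : Perm α) p, φ (σ • p) = σ • φ p) →
      (∀ F : α × α × α → ℝ, (distinctSum fun p => F (φ p)) = distinctSum F) →
      H (Sum.inr b, Sum.inl (φ (a₀, a₁, a₂)).1, Sum.inl (φ (a₀, a₁, a₂)).2.1) =
        c * ((m - 2) * distinctSumPair fun x y => G (Sum.inr b, Sum.inl x, Sum.inl y)) ∧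
      H (Sum.inl (φ (a₀, a₁, a₂)).1, Sum.inr b, Sum.inl (φ (a₀, a₁, a₂)).2.1) =
        c * ((m - 2) * distinctSumPair fun x y => G (Sum.inl x, Sum.inr b, Sum.inl y)) ∧
      H (Sum.inl (φ (a₀, a₁, a₂)).1, Sum.inl (φ (a₀, a₁, a₂)).2.1, Sum.inr b) =
        c * ((m - 2) * distinctSumPair fun x y => G (Sum.inl x, Sum.inl y, Sum.inr b)) := by
    intro b φ hφ hD
    have hb : ∀ a a' : α, (Sum.inr b : α ⊕ β) = swap (Sum.inl a) (Sum.inl a') (Sum.inr b) :=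
      fun a a' => (Equiv.swap_apply_of_ne_of_ne (by simp) (by simp)).symm
    refine ⟨?_, ?_, ?_⟩
    · rw [hH, hL' G fun p => (Sum.inr b, Sum.inl (φ p).1, Sum.inl (φ p).2.1)]
      · rw [hD fun p => G (Sum.inr b, Sum.inl p.1, Sum.inl p.2.1),
          distinctSum_eq_pair fun x y => G (Sum.inr b, Sum.inl x, Sum.inl y)]
      · intro a a' x
        simp only [hφ, Prod.smul_fst, Prod.smul_snd, Perm.smul_def, Prod.smul_mk, hswap, ← hb]
    · rw [hH, hL' G fun p => (Sum.inl (φ p).1, Sum.inr b, Sum.inl (φ p).2.1)]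
      · rw [hD fun p => G (Sum.inl p.1, Sum.inr b, Sum.inl p.2.1),
          distinctSum_eq_pair fun x y => G (Sum.inl x, Sum.inr b, Sum.inl y)]
      · intro a a' x
        simp only [hφ, Prod.smul_fst, Prod.smul_snd, Perm.smul_def, Prod.smul_mk, hswap, ← hb]
    · rw [hH, hL' G fun p => (Sum.inl (φ p).1, Sum.inl (φ p).2.1, Sum.inr b)]
      · rw [hD fun p => G (Sum.inl p.1, Sum.inl p.2.1, Sum.inr b),
          distinctSum_eq_pair fun x y => G (Sum.inl x, Sum.inl y, Sum.inr b)]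
      · intro a a' x
        simp only [hφ, Prod.smul_fst, Prod.smul_snd, Perm.smul_def, Prod.smul_mk, hswap, ← hb]
  have D1 : ∀ F : α × α × α → ℝ,
      (distinctSum fun p => F (p.2.1, p.2.2, p.1)) = distinctSum F := fun F =>
    (distinctSum_swap₁₂ fun p => F (p.1, p.2.2, p.2.1)).trans (distinctSum_swap₂₃ F)
  have D2 : ∀ F : α × α × α → ℝ,
      (distinctSum fun p => F (p.2.2, p.2.1, p.1)) = distinctSum F := fun F =>
    (distinctSum_swap₂₃ fun p => F (p.2.1, p.2.2, p.1)).trans (D1 F)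
  have A0 := A id (fun _ _ => rfl) fun _ => rfl
  have A1 := A (fun p => (p.2.1, p.1, p.2.2)) (fun _ _ => rfl) distinctSum_swap₁₂
  have A2 := A (fun p => (p.2.2, p.2.1, p.1)) (fun _ _ => rfl) D2
  have A3 := A (fun p => (p.2.1, p.2.2, p.1)) (fun _ _ => rfl) D1
  have B1 := fun b => B b (fun p => (p.2.1, p.2.2, p.1)) (fun _ _ => rfl) D1
  have B2 := fun b => B b (fun p => (p.2.2, p.2.1, p.1)) (fun _ _ => rfl) D2
  simp only [id] at A0 A1 A2 A3 B1 B2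
  have S0 := hSG _ H (Sum.inl a₀, Sum.inl a₁, Sum.inl a₂)
    (fun b => (Sum.inr b, Sum.inl a₁, Sum.inl a₂))
    (fun b => by simp [Equiv.swap_apply_of_ne_of_ne, h01.symm, h02.symm])
    (fun b b' h => by
      simp [Equiv.swap_apply_of_ne_of_ne, h01.symm, h02.symm, h])
  have S1 := hSG _ H (Sum.inl a₁, Sum.inl a₀, Sum.inl a₂)
    (fun b => (Sum.inl a₁, Sum.inr b, Sum.inl a₂))
    (fun b => by simp [Equiv.swap_apply_of_ne_of_ne, h01.symm, h02.symm])
    (fun b b' h => by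
      simp [Equiv.swap_apply_of_ne_of_ne, h01.symm, h02.symm, h])
  have S2 := hSG _ H (Sum.inl a₂, Sum.inl a₁, Sum.inl a₀)
    (fun b => (Sum.inl a₂, Sum.inl a₁, Sum.inr b))
    (fun b => by simp [Equiv.swap_apply_of_ne_of_ne, h01.symm, h02.symm])
    (fun b b' h => by
      simp [Equiv.swap_apply_of_ne_of_ne, h01.symm, h02.symm, h])
  have S3 := hSG _ H (Sum.inl a₁, Sum.inl a₂, Sum.inl a₀)
    (fun b => (Sum.inl a₁, Sum.inl a₂, Sum.inr b))
    (fun b => by simp [Equiv.swap_apply_of_ne_of_ne, h01.symm, h02.symm])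
    (fun b b' h => by
      simp [Equiv.swap_apply_of_ne_of_ne, h01.symm, h02.symm, h])
  have T1 : swap (Sum.inl a₀ : α ⊕ β) (Sum.inl a₁) • ((Sum.inl a₀ : α ⊕ β),
      (Sum.inl a₁ : α ⊕ β), (Sum.inl a₂ : α ⊕ β)) =
      (Sum.inl a₁, Sum.inl a₀, Sum.inl a₂) := by
    simp [Equiv.swap_apply_of_ne_of_ne, h12.symm, h02.symm]
  have T2 : swap (Sum.inl a₀ : α ⊕ β) (Sum.inl a₂) • ((Sum.inl a₀ : α ⊕ β),
      (Sum.inl a₁ : α ⊕ β), (Sum.inl a₂ : α ⊕ β)) =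
      (Sum.inl a₂, Sum.inl a₁, Sum.inl a₀) := by
    simp [Equiv.swap_apply_of_ne_of_ne, h12, h01.symm]
  have T3 : swap (Sum.inl a₀ : α ⊕ β) (Sum.inl a₂) • ((Sum.inl a₁ : α ⊕ β),
      (Sum.inl a₀ : α ⊕ β), (Sum.inl a₂ : α ⊕ β)) =
      (Sum.inl a₁, Sum.inl a₂, Sum.inl a₀) := by
    simp [Equiv.swap_apply_of_ne_of_ne, h12, h01.symm]
  have hw : 1 - 3 / (3 * M + m - 2) * M = (m - 2) / (3 * M + m - 2) := by
    field_simp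
    ring
  simp only [expect_cons, expect_append, T1, T2, T3, ← hH, S0, S1, S2, S3, A0, A1, A2, A3,
    (B1 _).1, (B1 _).2.1, (B1 _).2.2, (B2 _).2.2, hw, leftSum, ← Finset.mul_sum]
  ring

end Triples

end LazyShuffle

namespace LazyShuffle

open Equiv

/-! ### Symmetrizing two copies of the positions -/

section Merge

variable {α : Type} [DecidableEq α]

/-- The fair lazy transposition of the two copies of `a` in `α ⊕ α`. -/
noncomputable def mergeSwap (a : α) : LazySwap (α ⊕ α) :=
  ⟨Sum.inl a, Sum.inr a, by simp, 1 / 2, by norm_num, by norm_num⟩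

/-- The exchange of the two copies of `a` in `α ⊕ α`. -/
def copySwap (a : α) : Perm (α ⊕ α) := swap (Sum.inl a) (Sum.inr a)

lemma copySwap_commute (a b : α) : Commute (copySwap a) (copySwap b) := by
  rcases eq_or_ne a b with rfl | h
  · exact Commute.refl _
  · exact (Perm.disjoint_swap_swap (by simp [h])).commute

/-- The exchanges of different pairs commute, so the extra exchange can be carried to the fair one
of the same pair, which absorbs it. -/
lemma expect_merge_copySwap {X : Type*} [MulAction (Perm (α ⊕ α)) X] (l : List α) (G : X → ℝ)
    {a : α} (ha : a ∈ l) (x : X) :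
    expect (l.map mergeSwap) G (copySwap a • x) = expect (l.map mergeSwap) G x := by
  induction l generalizing x with
  | nil => simp at ha
  | cons b l ih =>
    have key : ∀ x : X, expect ((b :: l).map mergeSwap) G x =
        1 / 2 * expect (l.map mergeSwap) G (copySwap b • x) +
        (1 - 1 / 2) * expect (l.map mergeSwap) G x := fun x => rfl
    rw [key, key]
    rcases eq_or_ne a b with rfl | h
    · have : copySwap a • copySwap a • x = x := by
        rw [← mul_smul, copySwap, swap_mul_self, one_smul]
      rw [this]
      ring
    · have ha' : a ∈ l := (List.mem_cons.1 ha).resolve_left h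
      rw [← mul_smul, ← (copySwap_commute a b).eq, mul_smul, ih ha', ih ha']

lemma expect_merge_prod {X : Type*} [MulAction (Perm (α ⊕ α)) X] (l l' : List α) (G : X → ℝ)
    (h : ∀ a ∈ l', a ∈ l) (x : X) :
    expect (l.map mergeSwap) G ((l'.map copySwap).prod • x) = expect (l.map mergeSwap) G x := by
  induction l' with
  | nil => simp
  | cons a l' ih =>
    rw [List.map_cons, List.prod_cons, mul_smul, expect_merge_copySwap _ _ (h a (by simp)),
      ih fun b hb => h b (by simp [hb])]

lemma prod_copySwap_apply (l : List α) (hl : l.Nodup) (y : α ⊕ α) :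
    (l.map copySwap).prod y = if Sum.elim id id y ∈ l then y.swap else y := by
  induction l with
  | nil => simp
  | cons a l ih =>
    rw [List.nodup_cons] at hl
    rw [List.map_cons, List.prod_cons, Perm.mul_apply, ih hl.2]
    rcases y with b | b <;> rcases eq_or_ne b a with rfl | h <;> by_cases hb : b ∈ l <;>
      simp_all [copySwap, Equiv.swap_apply_of_ne_of_ne]

/-- Exchanging the two halves is the product of all `copySwap a`, each absorbed by the merge. -/
lemma expect_merge_swap [Fintype α]
    (G : (α ⊕ α) × (α ⊕ α) × (α ⊕ α) → ℝ) (p : (α ⊕ α) × (α ⊕ α) × (α ⊕ α)) :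
    expect ((Finset.univ : Finset α).toList.map mergeSwap) G (p.1.swap, p.2.1.swap, p.2.2.swap) =
      expect ((Finset.univ : Finset α).toList.map mergeSwap) G p := by
  rw [← expect_merge_prod (Finset.univ : Finset α).toList Finset.univ.toList G (fun _ h => h) p]
  congr 1
  obtain ⟨x, y, z⟩ := p
  simp only [Prod.smul_mk, Perm.smul_def, prod_copySwap_apply _ (Finset.nodup_toList _),
    Finset.mem_toList, Finset.mem_univ, if_true]

end Merge

/-! ### Recursions for three counters and the single-counter star -/

section Constructions

variable {α : Type} [Fintype α] [DecidableEq α]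

lemma canShuffle_of_triple {k : ℕ} (p : α × α × α)
    (hp : p.1 ≠ p.2.1 ∧ p.1 ≠ p.2.2 ∧ p.2.1 ≠ p.2.2) (L : List (LazySwap α)) (hL : L.length = k)
    (h : ∃ c : ℝ, ∀ G : α × α × α → ℝ, expect L G p = c * distinctSum G) :
    CanShuffle (Fin 3) α k :=
  ⟨⟨tripleEquiv α p, injective_vec_three.2 hp⟩, L, hL, (shuffles_fin_three_iff L p).2 h⟩

lemma CanShuffle.double {k : ℕ} (h : CanShuffle (Fin 3) α k) :
    CanShuffle (Fin 3) (α ⊕ α) (k + 2 * Fintype.card α + 2) := by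
  have hα : 0 < Fintype.card α := by
    obtain ⟨f, -⟩ := h
    exact Fintype.card_pos_iff.2 ⟨f 0⟩
  obtain ⟨p, L, h1, h2, h3, hL, c, hc⟩ := exists_expect_eq_leftSum (β := α) h hα
  refine canShuffle_of_triple (Sum.inl p.1, Sum.inl p.2.1, Sum.inl p.2.2) (by simp [h1, h2, h3])
    (L ++ Finset.univ.toList.map mergeSwap) ?_ ⟨c / 2, fun G => ?_⟩
  · simp [hL]
    ring
  -- For the merged observable both summands of `distinctSum_sum` agree, so its `leftSum` is half of
  -- the full sum, whence `c / 2`.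
  · rw [expect_append, hc, ← distinctSum_expect (Finset.univ.toList.map mergeSwap) G,
      distinctSum_sum]
    simp only [expect_merge_swap]
    ring

lemma CanShuffle.succ {k : ℕ} (h : CanShuffle (Fin 3) α k) :
    CanShuffle (Fin 3) (α ⊕ Unit) (k + 3) := by
  obtain ⟨p, L, h1, h2, h3, hL, c, hc⟩ := exists_expect_eq_leftSum (β := Unit) h (by simp)
  refine canShuffle_of_triple (Sum.inl p.1, Sum.inl p.2.1, Sum.inl p.2.2) (by simp [h1, h2, h3])
    L ?_ ⟨c, fun G => ?_⟩
  · simp [hL]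
    ring
  -- A single new position cannot hold two counters, so `leftSum` is already everything and no
  -- merging is needed.
  · have : ∀ G : (Unit ⊕ α) × (Unit ⊕ α) × (Unit ⊕ α) → ℝ, leftSum G = 0 := by
      intro G
      simp [leftSum, distinctSum, distinctSumPair]
    rw [hc, distinctSum_sum, this, add_zero]

lemma canShuffle_one (n : ℕ) : CanShuffle (Fin 1) (Fin (n + 1)) n := by
  obtain ⟨L, hL, h⟩ := exists_star (0 : Fin (n + 1)) ((Finset.univ.erase 0).toList) (by simp)
    (Finset.nodup_toList _) (1 / (n + 1)) (by positivity) (by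
      rw [Finset.length_toList, Finset.card_erase_of_mem (Finset.mem_univ _), Finset.card_univ,
        Fintype.card_fin, Nat.add_sub_cancel, div_mul_eq_mul_div, one_mul]
      exact div_le_one_of_le₀ (by linarith) (by positivity))
  rw [Finset.length_toList, Finset.card_erase_of_mem (Finset.mem_univ _), Finset.card_univ,
        Fintype.card_fin, Nat.add_sub_cancel] at hL h
  suffices hs : Shuffles L fun _ : Fin 1 => (0 : Fin (n + 1)) from
    ⟨⟨fun _ => 0, fun _ _ _ => Subsingleton.elim _ _⟩, L, hL, hs⟩
  refine ⟨1 / (n + 1), fun G => ?_⟩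
  refine ((h _ G fun _ => 0).2 (fun b _ => b) ?_ ?_).trans ?_
  · intro b _
    funext i
    simp
  · intro b hb b' _ hbb'
    funext i
    simp only [Finset.mem_toList, Finset.mem_erase] at hb
    simp [Equiv.swap_apply_of_ne_of_ne hb.1 hbb']
  · have e : ∑ f : Fin 1 ↪ Fin (n + 1), G f = ∑ b : Fin (n + 1), G fun _ => b := by
      refine Fintype.sum_bijective (fun f : Fin 1 ↪ Fin (n + 1) => f 0) ⟨?_, ?_⟩ _ _ ?_
      · intro f g h
        ext i
        rw [Subsingleton.elim i 0]
        exact congrArg _ h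
      · exact fun b => ⟨⟨fun _ => b, fun _ _ _ => Subsingleton.elim _ _⟩, rfl⟩
      · intro f
        congr 1
        funext i
        rw [Subsingleton.elim i 0]
    have hn : (n : ℝ) + 1 ≠ 0 := by positivity
    rw [e, Finset.sum_map_toList, ← Finset.add_sum_erase _ _ (Finset.mem_univ (0 : Fin (n + 1)))]
    field_simp
    ring

end Constructions

/-! ### From expectations back to laws of permutations -/

section Law

variable {n : ℕ}

lemma sum_prob_mul (T : LazyTransposition n) (K : Perm (Fin n) → ℝ) :
    ∑ τ, T.prob τ * K τ = T.p * K (swap T.a T.b) + (1 - T.p) * K 1 := by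
  have hne : (1 : Perm (Fin n)) ≠ swap T.a T.b := fun h =>
    T.a_ne_b (swap_eq_one_iff.1 h.symm)
  have : ∀ τ, T.prob τ * K τ = (if τ = swap T.a T.b then T.p * K τ else 0) +
      if τ = 1 then (1 - T.p) * K τ else 0 := by
    intro τ
    unfold LazyTransposition.prob
    rcases eq_or_ne τ (swap T.a T.b) with rfl | h
    · simp [hne.symm]
    · rcases eq_or_ne τ 1 with rfl | h' <;> simp [*]
  simp only [this, Finset.sum_add_distrib, Finset.sum_ite_eq', Finset.mem_univ, if_true]

/-- A lazy transposition of `Fin n` as one of a general type of positions. -/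
def LazyTransposition.toLazySwap (T : LazyTransposition n) : LazySwap (Fin n) :=
  ⟨T.a, T.b, T.a_ne_b, T.p, T.p_nonneg, T.p_le_one⟩

/-- A lazy transposition of the positions `Fin n` in the sense of `LazyTransposition`. -/
def LazySwap.toLazyTransposition (T : LazySwap (Fin n)) : LazyTransposition n :=
  ⟨T.a, T.b, T.a_ne_b, T.p, T.p_nonneg, T.p_le_one⟩

/-- The random product is followed by left multiplication on the group, started at the identity; the
first transposition becomes the rightmost factor. -/
lemma sum_law_mul (L : List (LazyTransposition n)) (F : Perm (Fin n) → ℝ) :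
    ∑ σ, law L σ * F σ = expect (L.map LazyTransposition.toLazySwap) F 1 := by
  induction L generalizing F with
  | nil => simp [law]
  | cons T L ih =>
    have h1 : ∀ τ, ∑ σ, law L (σ * τ⁻¹) * F σ =
        expect (L.map LazyTransposition.toLazySwap) (fun ρ => F (ρ * τ)) 1 := by
      intro τ
      rw [← ih, ← Equiv.sum_comp (Equiv.mulRight τ)]
      simp
    have h2 : ∑ σ, law (T :: L) σ * F σ = ∑ τ, T.prob τ * ∑ σ, law L (σ * τ⁻¹) * F σ := by
      simp only [law, Finset.sum_mul, Finset.mul_sum]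
      rw [Finset.sum_comm]
      simp only [mul_assoc]
    rw [h2]
    simp only [h1]
    rw [sum_prob_mul T fun τ =>
      expect (L.map LazyTransposition.toLazySwap) (fun ρ => F (ρ * τ)) 1]
    rw [List.map_cons, expect_cons,
      ← expect_comp (fun ρ : Perm (Fin n) => ρ * swap T.a T.b) fun σ ρ => mul_assoc _ _ _]
    simp [LazyTransposition.toLazySwap]

lemma placementProb_eq {t : ℕ} (h : t ≤ n) (L : List (LazyTransposition n)) (f : Fin t ↪ Fin n) :
    placementProb h L f = expect (L.map LazyTransposition.toLazySwap)
      (fun g : Fin t → Fin n => if g = f then 1 else 0) (Fin.castLE h) := by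
  have := expect_comp (fun σ : Perm (Fin n) => σ • (Fin.castLE h : Fin t → Fin n))
    (fun σ τ => by simp [mul_smul]) (L.map LazyTransposition.toLazySwap)
    (fun g : Fin t → Fin n => if g = f then 1 else 0) 1
  rw [one_smul] at this
  rw [this, ← sum_law_mul, placementProb, Finset.sum_filter]
  refine Finset.sum_congr rfl fun σ _ => ?_
  simp [funext_iff]

lemma CanShuffle.mem_shuffleLengths {t k : ℕ} (h : CanShuffle (Fin t) (Fin n) k) :
    k ∈ shuffleLengths t n := by
  have htn : t ≤ n := by
    obtain ⟨f, -⟩ := h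
    simpa using Fintype.card_le_of_embedding f
  obtain ⟨L, hL, c, hc⟩ := h.exists_shuffles (Equiv.refl _) (Equiv.refl _)
    ⟨Fin.castLE htn, Fin.castLE_injective htn⟩
  refine ⟨L.map LazySwap.toLazyTransposition, ⟨htn, fun f => ?_⟩, by simpa using hL⟩
  have hLL : (L.map LazySwap.toLazyTransposition).map LazyTransposition.toLazySwap = L := by
    rw [List.map_map]
    exact List.map_id L
  -- The constant observable forces `c` to be the reciprocal of the number of placements; the
  -- indicator of `f` then reads off its probability.
  have h1 := hc fun _ => 1
  rw [expect_one] at h1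
  have h2 := hc fun g => if g = f then 1 else 0
  simp only [DFunLike.coe_fn_eq, Finset.sum_ite_eq', Finset.mem_univ, if_true, mul_one] at h2
  simp only [Finset.sum_const, Finset.card_univ, Fintype.card_embedding_eq, Fintype.card_fin,
    nsmul_eq_mul, mul_one, Nat.descFactorial_eq_factorial_mul_choose, Nat.cast_mul] at h1
  rw [placementProb_eq, hLL]
  exact h2.trans (eq_one_div_of_mul_eq_one_left h1.symm)

end Law

end LazyShuffle

namespace LazyShuffle

open Equiv

/-! ### Numerical bounds -/

/-- At most `k` lazy transpositions suffice to shuffle `t` counters over `n` positions. -/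
def ShuffleBound (t n k : ℕ) : Prop := ∃ k' ≤ k, CanShuffle (Fin t) (Fin n) k'

namespace ShuffleBound

lemma mono {t n k l : ℕ} (h : ShuffleBound t n k) (hkl : k ≤ l) : ShuffleBound t n l := by
  obtain ⟨k', hk, h⟩ := h
  exact ⟨k', hk.trans hkl, h⟩

lemma U_le {t n k : ℕ} (h : ShuffleBound t n k) : U t n ≤ k := by
  obtain ⟨k', hk, h⟩ := h
  exact (Nat.sInf_le h.mem_shuffleLengths).trans hk

lemma zero (n : ℕ) : ShuffleBound 0 n 0 := ⟨0, le_rfl, canShuffle_of_isEmpty⟩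

lemma one (n : ℕ) : ShuffleBound 1 (1 + n) n := by
  rw [add_comm]
  exact ⟨n, le_rfl, canShuffle_one n⟩

lemma add {s t n k l : ℕ} (h : ShuffleBound s (s + n) k) (h' : ShuffleBound t n l) :
    ShuffleBound (s + t) (s + n) (k + l) := by
  obtain ⟨k', hk, h⟩ := h
  obtain ⟨l', hl, h'⟩ := h'
  exact ⟨k' + l', add_le_add hk hl,
    ((h.congr (Equiv.refl _) finSumFinEquiv.symm).add h').congr finSumFinEquiv finSumFinEquiv⟩

lemma succ {n k : ℕ} (h : ShuffleBound 3 n k) : ShuffleBound 3 (n + 1) (k + 3) := by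
  obtain ⟨k', hk, h⟩ := h
  refine ⟨k' + 3, by omega, h.succ.congr (Equiv.refl _) (Fintype.equivFinOfCardEq ?_)⟩
  simp

lemma double {n k : ℕ} (h : ShuffleBound 3 n k) : ShuffleBound 3 (2 * n) (k + 2 * n + 2) := by
  obtain ⟨k', hk, h⟩ := h
  refine ⟨k' + 2 * n + 2, by omega, ?_⟩
  have := h.double
  rw [Fintype.card_fin] at this
  refine this.congr (Equiv.refl _) (Fintype.equivFinOfCardEq ?_)
  simp [two_mul]

end ShuffleBound

/-- The number of lazy transpositions used when the counters are shuffled one after another. -/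
def naiveLength (t n : ℕ) : ℕ := ∑ i ∈ Finset.range t, (n - 1 - i)

lemma naiveLength_succ_succ (t n : ℕ) :
    naiveLength (t + 1) (n + 1) = n + naiveLength t n := by
  rw [naiveLength, Finset.sum_range_succ', add_comm]
  congr 1
  exact Finset.sum_congr rfl fun i _ => by omega

lemma naiveLength_add_three (t n : ℕ) :
    naiveLength (3 + t) (3 + n) = 3 * n + 3 + naiveLength t n := by
  rw [add_comm 3 t, add_comm 3 n, naiveLength_succ_succ, naiveLength_succ_succ,
    naiveLength_succ_succ]
  ring

lemma naiveLength_add_choose {t n : ℕ} (h : t ≤ n) :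
    naiveLength t n + (t + 1).choose 2 = t * n := by
  induction t with
  | zero => simp [naiveLength]
  | succ t ih =>
    have := ih (by omega)
    have h2 : (t + 1 + 1).choose 2 = (t + 1) + (t + 1).choose 2 := by
      rw [Nat.choose_succ_succ' (t + 1) 1, Nat.choose_one_right]
    rw [h2, add_mul, one_mul, ← this, naiveLength, Finset.sum_range_succ]
    change naiveLength t n + _ + _ = _
    omega

lemma naiveLength_le (t n : ℕ) : naiveLength t n ≤ t * n := by
  refine (Finset.sum_le_card_nsmul _ _ n fun i _ => by omega).trans ?_
  simp

namespace ShuffleBound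

lemma naive {t n : ℕ} (h : t ≤ n) : ShuffleBound t n (naiveLength t n) := by
  induction t generalizing n with
  | zero => exact zero n
  | succ t ih =>
    obtain ⟨m, rfl⟩ : ∃ m, n = m + 1 := ⟨n - 1, by omega⟩
    have := (one m).add (ih (n := m) (by omega))
    rwa [add_comm 1 t, add_comm 1 m, ← naiveLength_succ_succ] at this

lemma three_naive (n : ℕ) : ShuffleBound 3 (3 + n) (3 * n + 3) := by
  have := naive (show 3 ≤ 3 + n by omega)
  rwa [show naiveLength 3 (3 + n) = 3 * n + 3 from naiveLength_add_three 0 n] at this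

/-- A single doubling of the naive shuffle suffices. The ratio 14/15 is attained at seven positions,
where this costs 14 instead of 15. -/
lemma three_saving {n : ℕ} (h : 3 ≤ n) : ∃ k, 15 * k ≤ 14 * (3 * n + 3) ∧
    ShuffleBound 3 (3 + n) k := by
  obtain ⟨m, hm⟩ : ∃ m, 3 + n = 2 * (3 + m) ∨ 3 + n = 2 * (3 + m) + 1 :=
    ⟨(n - 3) / 2, by omega⟩
  have hd := (three_naive m).double
  rcases hm with hm | hm
  · exact ⟨_, by omega, hm ▸ hd⟩
  · exact ⟨_, by omega, hm ▸ hd.succ⟩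

/-- Halving n costs an overhead of at most 5: 2 from the doubling and 3 from a possible odd
position. -/
lemma three_log {n : ℕ} (h : 3 ≤ n) : ShuffleBound 3 n (2 * n + 5 * Nat.log 2 n) := by
  induction n using Nat.strong_induction_on with
  | _ n ih =>
    have hlog : Nat.log 2 n = Nat.log 2 (n / 2) + 1 :=
      Nat.log_of_one_lt_of_le (by norm_num) (by omega)
    rcases Nat.lt_or_ge n 6 with h6 | h6
    · obtain ⟨m, rfl⟩ : ∃ m, n = 3 + m := ⟨n - 3, by omega⟩
      exact (three_naive m).mono (by omega)
    · have hd := (ih (n / 2) (by omega) (by omega)).double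
      rcases Nat.even_or_odd' n with ⟨m, hm | hm⟩
      · have e : 2 * (n / 2) = n := by omega
        rw [e] at hd
        exact hd.mono (by omega)
      · have hs := hd.succ
        have e : 2 * (n / 2) + 1 = n := by omega
        rw [e] at hs
        exact hs.mono (by omega)

/-- Triples are split off while the rest still admits a saving. The last triple saves 1/15 of its
naive cost, and the naive remainder costs no more than that triple, so 1/30 is saved overall. -/
lemma saving {t n : ℕ} (ht : t ≤ n) (hn : 3 ≤ n) :
    ∃ k, 30 * k ≤ 29 * naiveLength (3 + t) (3 + n) ∧ ShuffleBound (3 + t) (3 + n) k := by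
  induction t using Nat.strong_induction_on generalizing n with
  | _ t ih =>
    obtain ⟨k, hk, hb⟩ := three_saving hn
    rw [naiveLength_add_three]
    by_cases hc : 3 ≤ t ∧ 6 ≤ n
    · obtain ⟨s, rfl⟩ : ∃ s, t = 3 + s := ⟨t - 3, by omega⟩
      obtain ⟨m, rfl⟩ : ∃ m, n = 3 + m := ⟨n - 3, by omega⟩
      obtain ⟨l, hl, hb'⟩ := ih s (by omega) (n := m) (by omega) (by omega)
      exact ⟨k + l, by omega, hb.add hb'⟩
    · have hle : naiveLength t n ≤ 3 * n + 3 := by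
        rcases Nat.lt_or_ge t 3 with h | h
        · have := naiveLength_le t n
          have : t * n ≤ 2 * n := Nat.mul_le_mul_right n (by omega)
          omega
        · have hn5 : n ≤ 5 := by omega
          interval_cases n <;> interval_cases t <;> decide
      exact ⟨k + naiveLength t n, by omega, hb.add (naive ht)⟩

lemma blocks (l r : ℕ) {n : ℕ} (h : 3 * l + r ≤ n) :
    ShuffleBound (3 * l + r) n (l * (2 * n + 5 * Nat.log 2 n) + r * n) := by
  induction l generalizing n with
  | zero =>
    rw [mul_zero, zero_add] at h ⊢
    exact (naive h).mono ((naiveLength_le r n).trans (by simp))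
  | succ l ih =>
    obtain ⟨m, rfl⟩ : ∃ m, n = 3 + m := ⟨n - 3, by omega⟩
    have hb := (three_log (n := 3 + m) (by omega)).add (ih (n := m) (by omega))
    rw [show 3 * (l + 1) + r = 3 + (3 * l + r) by ring]
    refine hb.mono ?_
    have hlog : Nat.log 2 m ≤ Nat.log 2 (3 + m) := Nat.log_mono_right (by omega)
    have h1 : l * (2 * m + 5 * Nat.log 2 m) ≤ l * (2 * (3 + m) + 5 * Nat.log 2 (3 + m)) :=
      Nat.mul_le_mul_left l (by omega)
    have h2 : r * m ≤ r * (3 + m) := Nat.mul_le_mul_left r (by omega)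
    rw [add_mul l 1, one_mul]
    omega

end ShuffleBound

end LazyShuffle

/-- The first conjunct says that the minimum defining `U t n` is attained for all `t ≤ n`. -/
theorem theorem2 :
    (∀ t n : ℕ, t ≤ n → IsLeast (LazyShuffle.shuffleLengths t n) (LazyShuffle.U t n)) ∧
    (∃ ε : ℝ, 0 < ε ∧ ∀ t n : ℕ, 3 ≤ t → t ≤ n → 6 ≤ n →
      (LazyShuffle.U t n : ℝ) ≤ (1 - ε) * ((t : ℝ) * (n : ℝ) - ((t + 1).choose 2 : ℝ))) ∧
    (∀ l : ℕ, ∃ C : ℝ, ∀ r n : ℕ, 3 * l + r ≤ n →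
      (LazyShuffle.U (3 * l + r) n : ℝ) ≤
        (2 * (l : ℝ) + (r : ℝ)) * (n : ℝ) + C * Real.log (n : ℝ)) := by
  refine ⟨fun t n h => ?_, ⟨1 / 30, by norm_num, fun t n h3 htn h6 => ?_⟩,
    fun l => ⟨l * (5 / Real.log 2), fun r n h => ?_⟩⟩
  · obtain ⟨k, -, hk⟩ := LazyShuffle.ShuffleBound.naive h
    exact ⟨Nat.sInf_mem ⟨k, hk.mem_shuffleLengths⟩, fun m hm => Nat.sInf_le hm⟩
  · obtain ⟨s, rfl⟩ : ∃ s, t = 3 + s := ⟨t - 3, by omega⟩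
    obtain ⟨m, rfl⟩ : ∃ m, n = 3 + m := ⟨n - 3, by omega⟩
    obtain ⟨k, hk, hb⟩ := LazyShuffle.ShuffleBound.saving (t := s) (n := m) (by omega) (by omega)
    have h1 : (LazyShuffle.U (3 + s) (3 + m) : ℝ) ≤ k := by exact_mod_cast hb.U_le
    have h2 : (30 : ℝ) * k ≤ 29 * LazyShuffle.naiveLength (3 + s) (3 + m) := by
      exact_mod_cast hk
    have h3 : (LazyShuffle.naiveLength (3 + s) (3 + m) : ℝ) + ((3 + s + 1).choose 2 : ℕ) =
        ((3 + s : ℕ) : ℝ) * ((3 + m : ℕ) : ℝ) := by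
      exact_mod_cast LazyShuffle.naiveLength_add_choose htn
    rw [← h3]
    linarith
  · have h1 : (LazyShuffle.U (3 * l + r) n : ℝ) ≤
        l * (2 * n + 5 * (Nat.log 2 n : ℕ)) + r * n := by
      exact_mod_cast (LazyShuffle.ShuffleBound.blocks l r h).U_le
    have h2 : (Nat.log 2 n : ℝ) ≤ Real.log n / Real.log 2 := by
      have := Real.natLog_le_logb n 2
      rwa [Real.logb, Nat.cast_ofNat] at this
    have h3 : (l : ℝ) * (5 * (Nat.log 2 n : ℕ)) ≤ l * (5 * (Real.log n / Real.log 2)) := by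
      gcongr
    calc (LazyShuffle.U (3 * l + r) n : ℝ) ≤ l * (2 * n + 5 * (Nat.log 2 n : ℕ)) + r * n := h1
      _ ≤ l * (2 * n) + l * (5 * (Real.log n / Real.log 2)) + r * n := by linarith
      _ = (2 * (l : ℝ) + (r : ℝ)) * (n : ℝ) + l * (5 / Real.log 2) * Real.log n := by ring
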